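/- Let $(X,Y)$ be a pair of real-valued random variables on a probability space, and let $\mathcal B$ be the Borel $\sigma$-field of $\mathbb R$. Let $\mathcal X := \{x\in\mathbb R : \mathbb P(X\le x)>0 \text{ and } \mathbb P(X\ge x)>0\}$ be the range of $X$. For sets $A,B\subset\mathbb R$ write $A<B$ if $a<b$ for all $a\in A$, $b\in B$. For probability measures $P,Q$ on $\mathbb R$ write $P\le_{\mathrm{lr}}Q$ if there exist a $\sigma$-finite measure $m$ and densities $f=\mathrm dP/\mathrm dm$, $g=\mathrm dQ/\mathrm dm$ with values in $[0,\infty)$ such that $g/f$ (with value $\infty$ where $f=0<g$) is nondecreasing on $\{f+g>0\}$. A version of the conditional distribution of $Y$ given $X$ is a stochastic kernel $K$ from $\mathbb R$ to $\mathbb R$ (each $K(x,\cdot)$ is a probability measure on $\mathcal B$, each $K(\cdot,B)$ is measurable) such that $\mathbb P(X\in A,\,Y\in B)=\mathbb E\bigl(1_A(X)K(X,B)\bigr)$ for all $A,B\in\mathcal B$. The following three conditions are equivalent: (i) For all Borel sets $A_1<A_2$ and $B_1<B_2$, $$\mathbb P(X\in A_1,Y\in B_2)\,\mathbb P(X\in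 A_2,Y\in B_1)\ \le\ \mathbb P(X\in A_1,Y\in B_1)\,\mathbb P(X\in A_2,Y\in B_2).\qquad(*)$$ (ii) For all real numbers $x_0<x_1<x_2$ and $y_0<y_1<y_2$, inequality $(*)$ holds with $A_1=(x_0,x_1]$, $A_2=(x_1,x_2]$, $B_1=(y_0,y_1]$, $B_2=(y_1,y_2]$. (iii) There is a version $K$ of the conditional distribution of $Y$ given $X$ such that $K(x_1,\cdot)\le_{\mathrm{lr}}K(x_2,\cdot)$ for all $x_1<x_2$ in $\mathcal X$. Moreover, if these conditions hold, then a kernel $K$ as in (iii) is given explicitly by $$K(x,(y,\infty))=\sup_{a<x}\,\mathbb P(Y>y\mid a<X\le x)\quad\text{for } x\in\mathcal X,\ y\in\mathbb R,$$ where $\mathbb P(\cdot\mid a<X\le x):=0$ if $\mathbb P(a<X\le x)=0$, and by letting $K(x,\cdot)$ be the distribution of $Y$ for $x\notin\mathcal X$. -/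

import Mathlib

open MeasureTheory ProbabilityTheory Set
open scoped NNReal ENNReal

namespace LRKernel

/-- Elementwise strict order between sets of reals: every element of `A` is smaller than every
element of `B`. -/
def SetLT (A B : Set ℝ) : Prop := ∀ a ∈ A, ∀ b ∈ B, a < b

/-- Likelihood ratio order `P ≤_lr Q`: there are a σ-finite measure `m` and densities
`f = dP/dm`, `g = dQ/dm` such that `g / f` is isotonic on `{f + g > 0}`. The quotient is taken in
`[0, ∞]`, so it is `∞` where `f = 0 < g`. -/
def LikelihoodRatioLE (P Q : Measure ℝ) : Prop :=
  ∃ (m : Measure ℝ) (f g : ℝ → ℝ≥0), SigmaFinite m ∧ Measurable f ∧ Measurable g ∧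
    P = m.withDensity (fun y => (f y : ℝ≥0∞)) ∧
    Q = m.withDensity (fun y => (g y : ℝ≥0∞)) ∧
    MonotoneOn (fun y => (g y : ℝ≥0∞) / (f y : ℝ≥0∞)) {y | 0 < f y + g y}

section RandomPair

variable {Ω : Type*} [MeasurableSpace Ω]

/-- The TP2 inequality for the pair `(X, Y)` and the given sets:
`ℙ(X ∈ A₁, Y ∈ B₂) ℙ(X ∈ A₂, Y ∈ B₁) ≤ ℙ(X ∈ A₁, Y ∈ B₁) ℙ(X ∈ A₂, Y ∈ B₂)`. -/
def TP2Ineq (μ : Measure Ω) (X Y : Ω → ℝ) (A₁ A₂ B₁ B₂ : Set ℝ) : Prop :=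
  μ (X ⁻¹' A₁ ∩ Y ⁻¹' B₂) * μ (X ⁻¹' A₂ ∩ Y ⁻¹' B₁)
    ≤ μ (X ⁻¹' A₁ ∩ Y ⁻¹' B₁) * μ (X ⁻¹' A₂ ∩ Y ⁻¹' B₂)

/-- The range of `X`: all real `x` with `ℙ(X ≤ x) > 0` and `ℙ(X ≥ x) > 0`. -/
def rangeOf (μ : Measure Ω) (X : Ω → ℝ) : Set ℝ :=
  {x | 0 < μ {ω | X ω ≤ x} ∧ 0 < μ {ω | x ≤ X ω}}

/-- The stochastic kernel `K` describes the conditional distribution of `Y` given `X`: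
`ℙ(X ∈ A, Y ∈ B) = 𝔼(1_A(X) K(X, B))` for all Borel sets `A`, `B`. -/
structure IsCondKernel (μ : Measure Ω) (X Y : Ω → ℝ) (K : Kernel ℝ ℝ) : Prop where
  markov : IsMarkovKernel K
  disintegrate : ∀ A B : Set ℝ, MeasurableSet A → MeasurableSet B →
    μ (X ⁻¹' A ∩ Y ⁻¹' B) = ∫⁻ ω, A.indicator (fun x => K x B) (X ω) ∂μ

/-- `K(x₁, ·) ≤_lr K(x₂, ·)` for all `x₁ < x₂` in the range of `X`. -/
def IsLRIsotonic (μ : Measure Ω) (X : Ω → ℝ) (K : Kernel ℝ ℝ) : Prop :=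
  ∀ x₁ ∈ rangeOf μ X, ∀ x₂ ∈ rangeOf μ X, x₁ < x₂ → LikelihoodRatioLE (K x₁) (K x₂)

/-- `S(x, y) = sup_{a < x} ℙ(Y > y | a < X ≤ x)`. In Mathlib the conditional probability given an
event of probability zero is `0`. -/
noncomputable def leftSup (μ : Measure Ω) (X Y : Ω → ℝ) (x y : ℝ) : ℝ≥0∞ :=
  ⨆ a ∈ Iio x, (cond μ (X ⁻¹' Ioc a x)) (Y ⁻¹' Ioi y)

/-- `K` is the explicit kernel given by `K(x, (y, ∞)) = S(x, y)` for `x` in the range of `X`, and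
by the distribution of `Y` for all other `x`. -/
def IsExplicitKernel (μ : Measure Ω) (X Y : Ω → ℝ) (K : Kernel ℝ ℝ) : Prop :=
  (∀ x ∈ rangeOf μ X, ∀ y : ℝ, K x (Ioi y) = leftSup μ X Y x y) ∧
  (∀ x ∉ rangeOf μ X, K x = μ.map Y)

end RandomPair

end LRKernel

/-!
If `Q (a, b] / P (a, b]` increases from each interval to the next, then the left ratio
`k x = sup_a Q (a, x] / P (a, x]` is monotone, and `k` is a density of `Q` with respect to `P`:
where `k` is continuous, the quotients of `Q` and `P` on small intervals around `x` are squeezed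
between nearby values of `k`, so Besicovitch differentiation identifies `k` with the Radon–Nikodym
derivative; the remaining points are countably many and only matter if they are atoms, where `k`
has the right value as well.

Applied to `P + Q` this yields the monotone density ratio of the likelihood ratio order, which
extends an inequality from adjacent intervals to all ordered Borel sets. Doing so in `y` and then
in `x` gives (ii) ⇒ (i). Under (i), `k` for the measures `ℙ(X ∈ ·)` and `ℙ(X ∈ ·, Y > y)` is
`leftSup`, a density that disintegrates the law of `(X, Y)`. As a limit of the laws of `Y` given
`a < X ≤ x`, which (i) orders, the resulting kernel is isotonic.
-/

namespace LRKernel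

open Filter Topology

section ENNReal

theorem div_le_div_of_mul_le_mul {u v u' v' : ℝ≥0∞} (h₀ : v' = 0 → u = 0) (hv' : v' ≠ ∞)
    (h : u * v' ≤ v * u') : u / v ≤ u' / v' := by
  rcases eq_or_ne v' 0 with h0 | h0
  · simp [h₀ h0]
  refine ENNReal.div_le_of_le_mul' ?_
  rwa [← mul_div_assoc, ENNReal.le_div_iff_mul_le (.inl h0) (.inl hv')]

theorem lintegral_mul_lintegral_mono_ae {α β : Type*} [MeasurableSpace α] [MeasurableSpace β]
    {m : Measure α} {n : Measure β} {u u' : α → ℝ≥0∞} {v v' : β → ℝ≥0∞} (hu : Measurable u)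
    (hu' : Measurable u') (hv : Measurable v) (hv' : Measurable v')
    (h : ∀ᵐ s ∂m, ∀ᵐ t ∂n, u s * v t ≤ u' s * v' t) :
    (∫⁻ s, u s ∂m) * ∫⁻ t, v t ∂n ≤ (∫⁻ s, u' s ∂m) * ∫⁻ t, v' t ∂n := by
  rw [← lintegral_mul_const _ hu, ← lintegral_mul_const _ hu']
  refine lintegral_mono_ae ?_
  filter_upwards [h] with s hs
  rw [← lintegral_const_mul _ hv, ← lintegral_const_mul _ hv']
  exact lintegral_mono_ae hs

end ENNReal

section MeasureReal

theorem measure_Ioc_add_measure_Ioc (P : Measure ℝ) {a b c : ℝ} (hab : a ≤ b) (hbc : b ≤ c) :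
    P (Ioc a b) + P (Ioc b c) = P (Ioc a c) := by
  rw [← Ioc_union_Ioc_eq_Ioc hab hbc, measure_union (Ioc_disjoint_Ioc_of_le le_rfl)
    measurableSet_Ioc]

theorem measure_singleton_add_measure_Ioc (P : Measure ℝ) {a b : ℝ} (hab : a ≤ b) :
    P {a} + P (Ioc a b) = P (Icc a b) := by
  rw [← Ioc_insert_left hab, insert_eq, measure_union (by simp) measurableSet_Ioc]

theorem tendsto_measure_Ioc_sub (P : Measure ℝ) [IsLocallyFiniteMeasure P] (x : ℝ) :
    Tendsto (fun r => P (Ioc (x - r) x)) (𝓝[>] 0) (𝓝 (P {x})) := by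
  have hInter : ⋂ r > 0, Ioc (x - r) x = {x} := by
    ext z
    simp only [mem_iInter, mem_Ioc, mem_singleton_iff]
    refine ⟨fun h => le_antisymm (h 1 one_pos).2 ?_, ?_⟩
    · exact le_of_forall_pos_sub_le fun r hr => (h r hr).1.le
    · rintro rfl r hr
      exact ⟨sub_lt_self z hr, le_rfl⟩
  rw [← hInter]
  exact tendsto_measure_biInter_gt (fun _ _ => nullMeasurableSet_Ioc)
    (fun r s _ hrs => Ioc_subset_Ioc_left (by gcongr)) ⟨1, one_pos, measure_Ioc_lt_top.ne⟩

end MeasureReal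

/-- Likelihood ratio order tested on adjacent half-open intervals, in cross-multiplied form: the
ratio `Q / P` of a bounded interval does not exceed that of the interval to its right. -/
def IocRatioLE (P Q : Measure ℝ) : Prop :=
  ∀ a b c : ℝ, P (Ioc b c) * Q (Ioc a b) ≤ P (Ioc a b) * Q (Ioc b c)

/-- The left ratio at `x`, which is the candidate for the density `dQ/dP`: the supremum over `a` of
the quotients `Q (a, x] / P (a, x]`. Quotients of null intervals are `0 / 0 = 0` when `Q ≪ P`, so
that points without mass on their left need no special treatment. -/
noncomputable def leftRatio (Q P : Measure ℝ) (x : ℝ) : ℝ≥0∞ :=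
  ⨆ a, Q (Ioc a x) / P (Ioc a x)

section LeftRatio

variable {P Q : Measure ℝ}

theorem IocRatioLE.add_left (h : IocRatioLE P Q) : IocRatioLE (P + Q) Q := by
  intro a b c
  simp only [Measure.coe_add, Pi.add_apply, add_mul, mul_comm (Q (Ioc b c))]
  gcongr ?_ + _
  exact h a b c

theorem IocRatioLE.smul (h : IocRatioLE P Q) (c d : ℝ≥0∞) : IocRatioLE (c • P) (d • Q) := by
  intro x y z
  simp only [Measure.smul_apply, smul_eq_mul, mul_mul_mul_comm c _ d]
  gcongr c * d * ?_
  exact h x y z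

theorem IocRatioLE.mul_Ioc_le_mul_Ioc (h : IocRatioLE P Q) {a b : ℝ} (hab : a ≤ b) (c : ℝ) :
    Q (Ioc a c) * P (Ioc b c) ≤ P (Ioc a c) * Q (Ioc b c) := by
  rcases lt_or_ge c b with hcb | hbc
  · simp [Ioc_eq_empty_of_le hcb.le]
  simp only [← measure_Ioc_add_measure_Ioc _ hab hbc, add_mul]
  rw [mul_comm (Q (Ioc b c)), mul_comm (Q (Ioc a b))]
  gcongr ?_ + _
  exact h a b c

theorem leftRatio_le_one (hQP : Q ≤ P) (x : ℝ) : leftRatio Q P x ≤ 1 :=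
  iSup_le fun _ => ENNReal.div_le_of_le_mul (by simpa using hQP _)

theorem IocRatioLE.leftRatio_mul_measure_Ioc_le (h : IocRatioLE P Q) (a b : ℝ) :
    leftRatio Q P a * P (Ioc a b) ≤ Q (Ioc a b) := by
  simp only [leftRatio, ENNReal.iSup_mul]
  refine iSup_le fun c => ?_
  rw [← ENNReal.mul_div_right_comm, mul_comm (Q _)]
  exact ENNReal.div_le_of_le_mul' (h c a b)

theorem leftRatio_eq_of_measure_Ioc_eq_zero (hQP : Q ≪ P) {x z : ℝ} (hxz : x ≤ z)
    (hP : P (Ioc x z) = 0) :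
    leftRatio Q P x = leftRatio Q P z := by
  have hIoc : ∀ R : Measure ℝ, R (Ioc x z) = 0 → ∀ a, R (Ioc a x) = R (Ioc a z) := fun R hR a =>
    (measure_mono (Ioc_subset_Ioc_right hxz)).antisymm <| calc
      R (Ioc a z) ≤ R (Ioc a x ∪ Ioc x z) := measure_mono Ioc_subset_Ioc_union_Ioc
      _ ≤ R (Ioc a x) := (measure_union_le _ _).trans (by rw [hR, add_zero])
  simp only [leftRatio, hIoc P hP, hIoc Q (hQP hP)]

variable [IsLocallyFiniteMeasure P]

theorem IocRatioLE.div_Ioc_le_div_Ioc (h : IocRatioLE P Q) (hQP : Q ≪ P) (a : ℝ) {b c : ℝ}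
    (hbc : b ≤ c) : Q (Ioc a b) / P (Ioc a b) ≤ Q (Ioc a c) / P (Ioc a c) := by
  rcases lt_or_ge b a with hba | hab
  · simp [Ioc_eq_empty_of_le hba.le]
  refine div_le_div_of_mul_le_mul (fun h0 => ?_) measure_Ioc_lt_top.ne ?_
  · exact measure_mono_null (Ioc_subset_Ioc_right hbc) (hQP h0)
  · simp only [← measure_Ioc_add_measure_Ioc _ hab hbc, mul_add]
    rw [mul_comm (Q (Ioc a b)), mul_comm (Q (Ioc a b))]
    gcongr _ + ?_
    exact h a b c

theorem IocRatioLE.monotone_leftRatio (h : IocRatioLE P Q) (hQP : Q ≪ P) :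
    Monotone (leftRatio Q P) :=
  fun _ _ hxz => iSup_mono fun a => h.div_Ioc_le_div_Ioc hQP a hxz

theorem measure_Ioc_le_leftRatio_mul (hQP : Q ≪ P) (a b : ℝ) :
    Q (Ioc a b) ≤ leftRatio Q P b * P (Ioc a b) := by
  rcases eq_or_ne (P (Ioc a b)) 0 with h0 | h0
  · simp [hQP h0]
  · rw [← ENNReal.div_le_iff h0 measure_Ioc_lt_top.ne]
    exact le_iSup (fun a => Q (Ioc a b) / P (Ioc a b)) a

theorem IocRatioLE.tendsto_leftRatio (h : IocRatioLE P Q) (hQP : Q ≪ P) (x : ℝ) :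
    Tendsto (fun a : {a // P (Ioc a x) ≠ 0} => Q (Ioc a x) / P (Ioc a x)) atTop
      (𝓝 (leftRatio Q P x)) := by
  have hsup : leftRatio Q P x = ⨆ a : {a // P (Ioc a x) ≠ 0}, Q (Ioc a x) / P (Ioc a x) := by
    rw [leftRatio, iSup_subtype]
    refine iSup_congr fun a => ?_
    by_cases h0 : P (Ioc a x) = 0
    · simp [h0, hQP h0]
    · simp [h0]
  rw [hsup]
  exact tendsto_atTop_iSup fun a b hab =>
    div_le_div_of_mul_le_mul (fun h0 => absurd h0 b.2) measure_Ioc_lt_top.ne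
      (h.mul_Ioc_le_mul_Ioc hab x)

variable [IsLocallyFiniteMeasure Q]

theorem IocRatioLE.leftRatio_mul_measure_singleton (h : IocRatioLE P Q) (hQP : Q ≪ P) (x : ℝ) :
    leftRatio Q P x * P {x} = Q {x} := by
  rcases eq_or_ne (P {x}) 0 with h0 | h0
  · simp [h0, hQP h0]
  have hP := tendsto_measure_Ioc_sub P x
  have hQ := tendsto_measure_Ioc_sub Q x
  apply le_antisymm
  · simp only [leftRatio, ENNReal.iSup_mul]
    refine iSup_le fun a => ?_
    rcases le_or_gt x a with hxa | hax
    · simp [Ioc_eq_empty_of_le hxa]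
    rw [← ENNReal.mul_div_right_comm]
    refine ENNReal.div_le_of_le_mul' (le_of_tendsto_of_tendsto
      (ENNReal.Tendsto.const_mul hP (.inr measure_Ioc_lt_top.ne))
      (ENNReal.Tendsto.const_mul hQ (.inr measure_Ioc_lt_top.ne)) ?_)
    filter_upwards [Ioo_mem_nhdsGT (sub_pos.mpr hax)] with r hr
    exact h.mul_Ioc_le_mul_Ioc (le_sub_comm.mp hr.2.le) x
  · exact le_of_tendsto_of_tendsto' hQ (ENNReal.Tendsto.const_mul hP (.inl h0))
      fun r => measure_Ioc_le_leftRatio_mul hQP (x - r) x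

theorem IocRatioLE.leftRatio_mul_measure_Icc_le (h : IocRatioLE P Q) (hQP : Q ≪ P) {a b : ℝ}
    (hab : a ≤ b) : leftRatio Q P a * P (Icc a b) ≤ Q (Icc a b) := by
  simp only [← measure_singleton_add_measure_Ioc _ hab, mul_add,
    h.leftRatio_mul_measure_singleton hQP]
  gcongr
  exact h.leftRatio_mul_measure_Ioc_le a b

theorem IocRatioLE.measure_Icc_le_leftRatio_mul (h : IocRatioLE P Q) (hQP : Q ≪ P) {a b : ℝ}
    (hab : a ≤ b) : Q (Icc a b) ≤ leftRatio Q P b * P (Icc a b) := by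
  simp only [← measure_singleton_add_measure_Ioc _ hab, mul_add,
    ← h.leftRatio_mul_measure_singleton hQP]
  gcongr
  · exact h.monotone_leftRatio hQP hab
  · exact measure_Ioc_le_leftRatio_mul hQP a b

theorem IocRatioLE.tendsto_closedBall_of_continuousAt (h : IocRatioLE P Q) (hQP : Q ≪ P) {x : ℝ}
    (hx : x ∈ P.support) (hcont : ContinuousAt (leftRatio Q P) x) :
    Tendsto (fun r => Q (Metric.closedBall x r) / P (Metric.closedBall x r)) (𝓝[>] 0)
      (𝓝 (leftRatio Q P x)) := by
  have hlo : Tendsto (fun r => leftRatio Q P (x - r)) (𝓝[>] 0) (𝓝 (leftRatio Q P x)) :=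
    hcont.tendsto.comp <| tendsto_nhdsWithin_of_tendsto_nhds <| by
      simpa using (continuous_sub_left x).tendsto 0
  have hhi : Tendsto (fun r => leftRatio Q P (x + r)) (𝓝[>] 0) (𝓝 (leftRatio Q P x)) :=
    hcont.tendsto.comp <| tendsto_nhdsWithin_of_tendsto_nhds <| by
      simpa using (continuous_const_add x).tendsto 0
  refine tendsto_of_tendsto_of_tendsto_of_le_of_le' hlo hhi ?_ ?_ <;>
    filter_upwards [self_mem_nhdsWithin] with r (hr : 0 < r)
  · have hpos := (Measure.mem_support_iff_forall x).mp hx _ (Metric.closedBall_mem_nhds x hr)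
    rw [Real.closedBall_eq_Icc] at hpos ⊢
    rw [ENNReal.le_div_iff_mul_le (.inl hpos.ne') (.inl measure_Icc_lt_top.ne)]
    exact h.leftRatio_mul_measure_Icc_le hQP (by linarith)
  · rw [Real.closedBall_eq_Icc]
    exact ENNReal.div_le_of_le_mul (h.measure_Icc_le_leftRatio_mul hQP (by linarith))

theorem IocRatioLE.rnDeriv_ae_eq_leftRatio (h : IocRatioLE P Q) (hQP : Q ≪ P) :
    Q.rnDeriv P =ᵐ[P] leftRatio Q P := by
  have hatom : ∀ᵐ x ∂P, ¬ContinuousAt (leftRatio Q P) x → P {x} ≠ 0 := by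
    rw [ae_iff]
    simp only [Classical.not_imp, not_not]
    have hcount := (h.monotone_leftRatio hQP).countable_not_continuousAt
    exact (measure_null_iff_singleton (hcount.mono fun x hx => hx.1)).mpr fun _ hx => hx.2
  filter_upwards [hatom, Measure.support_mem_ae, Besicovitch.ae_tendsto_rnDeriv Q P]
    with x hx hsupp hlim
  by_cases hcont : ContinuousAt (leftRatio Q P) x
  · exact tendsto_nhds_unique hlim (h.tendsto_closedBall_of_continuousAt hQP hsupp hcont)
  · rw [← ENNReal.mul_left_inj (hx hcont) measure_singleton_lt_top.ne,
      h.leftRatio_mul_measure_singleton hQP, ← lintegral_singleton,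
      Measure.setLIntegral_rnDeriv hQP]

theorem IocRatioLE.withDensity_leftRatio (h : IocRatioLE P Q) (hQP : Q ≪ P) :
    P.withDensity (leftRatio Q P) = Q := by
  rw [← withDensity_congr_ae (h.rnDeriv_ae_eq_leftRatio hQP),
    Measure.withDensity_rnDeriv_eq _ _ hQP]

theorem IocRatioLE.leftRatio_mul_measure_Ici_le (h : IocRatioLE P Q) (hQP : Q ≪ P) (x : ℝ) :
    leftRatio Q P x * P (Ici x) ≤ Q (Ici x) := calc
  leftRatio Q P x * P (Ici x) = ∫⁻ _ in Ici x, leftRatio Q P x ∂P := (setLIntegral_const _ _).symm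
  _ ≤ ∫⁻ z in Ici x, leftRatio Q P z ∂P :=
    setLIntegral_mono' measurableSet_Ici fun _ hz => h.monotone_leftRatio hQP hz
  _ = Q (Ici x) := by rw [← withDensity_apply _ measurableSet_Ici, h.withDensity_leftRatio hQP]

end LeftRatio

section LikelihoodRatio

variable {P Q : Measure ℝ}

theorem LikelihoodRatioLE.refl (P : Measure ℝ) [SigmaFinite P] : LikelihoodRatioLE P P :=
  ⟨P, 1, 1, inferInstance, measurable_one, measurable_one, by simp, by simp,
    fun _ _ _ _ _ => le_rfl⟩

theorem mul_le_mul_of_monotoneOn_div {α : Type*} [Preorder α] {f g : α → ℝ≥0}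
    (hfg : MonotoneOn (fun y => (g y : ℝ≥0∞) / (f y : ℝ≥0∞)) {y | 0 < f y + g y}) {s t : α}
    (hst : s ≤ t) : g s * f t ≤ f s * g t := by
  rcases eq_or_ne (f t) 0 with hft | hft
  · simp [hft]
  rcases eq_or_ne (g s) 0 with hgs | hgs
  · simp [hgs]
  have hratio : (g s : ℝ≥0∞) / f s ≤ g t / f t :=
    hfg (add_pos_of_nonneg_of_pos zero_le (pos_iff_ne_zero.mpr hgs))
      (add_pos_of_pos_of_nonneg (pos_iff_ne_zero.mpr hft) zero_le) hst
  have hfs : f s ≠ 0 := by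
    intro hfs
    rw [hfs, ENNReal.coe_zero, ENNReal.div_zero (by simpa), top_le_iff] at hratio
    exact ENNReal.div_ne_top ENNReal.coe_ne_top (by simpa) hratio
  rw [← ENNReal.coe_div hfs, ← ENNReal.coe_div hft, ENNReal.coe_le_coe,
    div_le_div_iff₀ (pos_iff_ne_zero.mpr hfs) (pos_iff_ne_zero.mpr hft)] at hratio
  rwa [mul_comm (f s)]

theorem LikelihoodRatioLE.measure_mul_le (h : LikelihoodRatioLE P Q) {A B : Set ℝ}
    (hA : MeasurableSet A) (hB : MeasurableSet B) (hAB : SetLT A B) :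
    P B * Q A ≤ P A * Q B := by
  obtain ⟨m, f, g, _, hf, hg, rfl, rfl, hfg⟩ := h
  rw [mul_comm]
  simp only [withDensity_apply _ hA, withDensity_apply _ hB]
  refine lintegral_mul_lintegral_mono_ae (by fun_prop) (by fun_prop) (by fun_prop) (by fun_prop) ?_
  filter_upwards [ae_restrict_mem hA] with s hs
  filter_upwards [ae_restrict_mem hB] with t ht
  exact_mod_cast mul_le_mul_of_monotoneOn_div hfg (hAB s hs t ht).le

theorem withDensity_one_sub_eq [IsFiniteMeasure Q] {k : ℝ → ℝ≥0∞}
    (hk : Measurable k) (hk_le : ∀ x, k x ≤ 1) (hQ : (P + Q).withDensity k = Q) :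
    (P + Q).withDensity (1 - k) = P := by
  have hadd : (1 - k) + k = 1 := tsub_add_cancel_of_le hk_le
  have hsum : (P + Q).withDensity (1 - k) + (P + Q).withDensity k = P + Q := by
    rw [← withDensity_add_right _ hk, hadd, withDensity_one]
  rwa [hQ, Measure.add_left_inj] at hsum

theorem IocRatioLE.likelihoodRatioLE [IsFiniteMeasure P] [IsFiniteMeasure Q]
    (h : IocRatioLE P Q) : LikelihoodRatioLE P Q := by
  have hQ_le : Q ≤ P + Q := Measure.le_add_left le_rfl
  have hQ_ac : Q ≪ P + Q := Measure.absolutelyContinuous_of_le hQ_le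
  set k := leftRatio Q (P + Q)
  have hk : Monotone k := h.add_left.monotone_leftRatio hQ_ac
  have hkm : Measurable k := hk.measurable
  have hk_le : ∀ x, k x ≤ 1 := leftRatio_le_one hQ_le
  have hkt : ∀ x, k x ≠ ∞ := fun x => ((hk_le x).trans_lt ENNReal.one_lt_top).ne
  have hQ : (P + Q).withDensity k = Q := h.add_left.withDensity_leftRatio hQ_ac
  have hP : (P + Q).withDensity (1 - k) = P := withDensity_one_sub_eq hkm hk_le hQ
  have h1k : ∀ x, ((1 - k x).toNNReal : ℝ≥0∞) = 1 - k x := fun x =>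
    ENNReal.coe_toNNReal (ENNReal.sub_ne_top ENNReal.one_ne_top)
  have hk' : ∀ x, ((k x).toNNReal : ℝ≥0∞) = k x := fun x => ENNReal.coe_toNNReal (hkt x)
  refine ⟨P + Q, fun x => (1 - k x).toNNReal, fun x => (k x).toNNReal, inferInstance,
    by fun_prop, by fun_prop, ?_, ?_, ?_⟩
  · simp only [h1k]
    exact hP.symm
  · simpa only [hk'] using hQ.symm
  · intro x _ y _ hxy
    simp only [h1k, hk']
    exact ENNReal.div_le_div (hk hxy) (tsub_le_tsub_left (hk hxy) 1)

theorem IocRatioLE.of_tendsto_Ioi [IsFiniteMeasure P] [IsFiniteMeasure Q] {ι : Type*}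
    {l : Filter ι} [l.NeBot] {p q : ι → Measure ℝ} [∀ i, IsFiniteMeasure (p i)]
    [∀ i, IsFiniteMeasure (q i)] (hpq : ∀ᶠ i in l, IocRatioLE (p i) (q i))
    (hp : ∀ y, Tendsto (fun i => p i (Ioi y)) l (𝓝 (P (Ioi y))))
    (hq : ∀ y, Tendsto (fun i => q i (Ioi y)) l (𝓝 (Q (Ioi y)))) : IocRatioLE P Q := by
  have hdiff : ∀ (R : Measure ℝ) [IsFiniteMeasure R] (a b : ℝ),
      R (Ioc a b) = R (Ioi a) - R (Ioi (max a b)) := fun R _ a b => by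
    rw [← measure_sdiff (Ioi_subset_Ioi (le_max_left a b)) nullMeasurableSet_Ioi
      (measure_ne_top _ _), Ioi_sdiff_Ioi]
    rcases le_total a b with hab | hab <;> simp [hab]
  have hlim : ∀ {R : Measure ℝ} [IsFiniteMeasure R] {r : ι → Measure ℝ}
      [∀ i, IsFiniteMeasure (r i)], (∀ y, Tendsto (fun i => r i (Ioi y)) l (𝓝 (R (Ioi y)))) →
      ∀ a b, Tendsto (fun i => r i (Ioc a b)) l (𝓝 (R (Ioc a b))) := fun hr a b => by
    simp only [hdiff]
    exact ENNReal.Tendsto.sub (hr _) (hr _) (.inl (measure_ne_top _ _))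
  intro a b c
  refine le_of_tendsto_of_tendsto
    (ENNReal.Tendsto.mul (hlim hp b c) (.inr (measure_ne_top _ _)) (hlim hq a b)
      (.inr (measure_ne_top _ _)))
    (ENNReal.Tendsto.mul (hlim hp a b) (.inr (measure_ne_top _ _)) (hlim hq b c)
      (.inr (measure_ne_top _ _))) ?_
  filter_upwards [hpq] with i hi using hi a b c

end LikelihoodRatio

section Tail

theorem tendsto_measure_Ioi_atBot (P : Measure ℝ) :
    Tendsto (fun t => P (Ioi t)) atBot (𝓝 (P univ)) := by
  rw [← iUnion_Ioi]
  exact tendsto_measure_iUnion_atBot antitone_Ioi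

theorem tendsto_measure_Ioi_atTop (P : Measure ℝ) [IsFiniteMeasure P] :
    Tendsto (fun t => P (Ioi t)) atTop (𝓝 0) := by
  have hInter : ⋂ t : ℝ, Ioi t = ∅ :=
    eq_empty_of_forall_notMem fun x hx => lt_irrefl x (mem_iInter.mp hx x)
  rw [← measure_empty (μ := P), ← hInter]
  exact tendsto_measure_iInter_atTop (fun _ => nullMeasurableSet_Ioi) antitone_Ioi
    ⟨0, measure_ne_top _ _⟩

theorem lowerSemicontinuous_measure_Ioi (P : Measure ℝ) :
    LowerSemicontinuous fun y => P (Ioi y) := by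
  intro y c hc
  obtain ⟨u, hu, hyu, hlim⟩ := exists_seq_strictAnti_tendsto y
  have hUnion : ⋃ n, Ioi (u n) = Ioi y := (isGLB_of_tendsto_atTop hu.antitone hlim).iUnion_Ioi_eq
  have hP : Tendsto (fun n => P (Ioi (u n))) atTop (𝓝 (P (Ioi y))) :=
    hUnion ▸ tendsto_measure_iUnion_atTop fun m n hmn => Ioi_subset_Ioi (hu.antitone hmn)
  obtain ⟨n, hn⟩ := (hP.eventually (lt_mem_nhds hc)).exists
  filter_upwards [Iio_mem_nhds (hyu n)] with z hz
  exact hn.trans_le (measure_mono (Ioi_subset_Ioi hz.le))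

theorem ae_measure_Iic_ne_zero {α : Type*} [TopologicalSpace α] [LinearOrder α] [OrderTopology α]
    [SecondCountableTopology α] [MeasurableSpace α] (P : Measure α) : ∀ᵐ x ∂P, P (Iic x) ≠ 0 := by
  rw [ae_iff]
  simp only [not_not]
  refine measure_null_of_locally_null _ fun x (hx : P (Iic x) = 0) => ?_
  by_cases hmax : ∃ y > x, P (Iic y) = 0
  · obtain ⟨y, hxy, hy⟩ := hmax
    exact ⟨Iic y, mem_nhdsWithin_of_mem_nhds (Iic_mem_nhds hxy), hy⟩
  · push Not at hmax
    exact ⟨_, self_mem_nhdsWithin, measure_mono_null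
      (fun y hy => not_lt.mp fun hxy => hmax y hxy hy) hx⟩

theorem ae_measure_Ici_ne_zero {α : Type*} [TopologicalSpace α] [LinearOrder α] [OrderTopology α]
    [SecondCountableTopology α] [MeasurableSpace α] (P : Measure α) : ∀ᵐ x ∂P, P (Ici x) ≠ 0 :=
  ae_measure_Iic_ne_zero (α := αᵒᵈ) P

theorem measure_ext_of_Ioi {P Q : Measure ℝ} [IsFiniteMeasure P] (huniv : P univ = Q univ)
    (h : ∀ y, P (Ioi y) = Q (Ioi y)) : P = Q := by
  refine ext_of_generate_finite _ (BorelSpace.measurable_eq.trans (borel_eq_generateFrom_Ioi ℝ))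
    isPiSystem_Ioi ?_ huniv
  rintro _ ⟨y, rfl⟩
  exact h y

/-- The survival function of a probability measure is right continuous; for an antitone function
this is lower semicontinuity, a property inherited by suprema. -/
theorem exists_isProbabilityMeasure_Ioi {S : ℝ → ℝ≥0∞} (hS : Antitone S)
    (hlsc : LowerSemicontinuous S) (hbot : Tendsto S atBot (𝓝 1)) (htop : Tendsto S atTop (𝓝 0)) :
    ∃ P : Measure ℝ, IsProbabilityMeasure P ∧ ∀ y, P (Ioi y) = S y := by
  have hSt : ∀ y, S y ≠ ∞ := fun y =>
    ((hS.ge_of_tendsto hbot y).trans_lt ENNReal.one_lt_top).ne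
  have hright : ∀ y, ContinuousWithinAt S (Ici y) y := fun y => by
    refine tendsto_order.mpr ⟨fun c hc => (hlsc y c hc).filter_mono nhdsWithin_le_nhds,
      fun c hc => ?_⟩
    filter_upwards [self_mem_nhdsWithin] with z hz using (hS hz).trans_lt hc
  let F : StieltjesFunction ℝ :=
    { toFun := fun y => 1 - (S y).toReal
      mono' := fun y z hyz => sub_le_sub_left (ENNReal.toReal_mono (hSt y) (hS hyz)) 1
      right_continuous' := fun y =>
        ((ENNReal.tendsto_toReal (hSt y)).comp (hright y)).const_sub 1 }
  have hF0 : Tendsto F atBot (𝓝 0) := by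
    simpa using ((ENNReal.tendsto_toReal ENNReal.one_ne_top).comp hbot).const_sub 1
  have hF1 : Tendsto F atTop (𝓝 1) := by
    simpa using ((ENNReal.tendsto_toReal ENNReal.zero_ne_top).comp htop).const_sub 1
  refine ⟨F.measure, F.isProbabilityMeasure hF0 hF1, fun y => ?_⟩
  rw [F.measure_Ioi hF1]
  change ENNReal.ofReal (1 - (1 - (S y).toReal)) = S y
  rw [sub_sub_cancel, ENNReal.ofReal_toReal (hSt y)]

end Tail

section RandomPair

variable {Ω : Type*} [MeasurableSpace Ω] {μ : Measure Ω} {X Y : Ω → ℝ}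

theorem setLT_Ioc (a b c : ℝ) : SetLT (Ioc a b) (Ioc b c) :=
  fun _ hs _ ht => hs.2.trans_lt ht.1

theorem tp2Ineq_comm {A₁ A₂ B₁ B₂ : Set ℝ} :
    TP2Ineq μ X Y A₁ A₂ B₁ B₂ ↔ TP2Ineq μ Y X B₁ B₂ A₁ A₂ := by
  simp only [TP2Ineq, inter_comm (X ⁻¹' _), mul_comm (μ (Y ⁻¹' B₂ ∩ _))]

/-- Condition (i) of the theorem: `(X, Y)` is totally positive of order two. -/
def IsTP2 (μ : Measure Ω) (X Y : Ω → ℝ) : Prop :=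
  ∀ A₁ A₂ B₁ B₂ : Set ℝ, MeasurableSet A₁ → MeasurableSet A₂ → MeasurableSet B₁ →
    MeasurableSet B₂ → SetLT A₁ A₂ → SetLT B₁ B₂ → TP2Ineq μ X Y A₁ A₂ B₁ B₂

/-- The unnormalized law of `Y` on the event `E`, that is `B ↦ ℙ(Y ∈ B, E)`. Unlike a conditional
law it is additive in `E`. -/
noncomputable def lawOn (μ : Measure Ω) (Y : Ω → ℝ) (E : Set Ω) : Measure ℝ :=
  (μ.restrict E).map Y

instance [IsFiniteMeasure μ] (E : Set Ω) : IsFiniteMeasure (lawOn μ Y E) :=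
  inferInstanceAs (IsFiniteMeasure ((μ.restrict E).map Y))

theorem lawOn_apply (hY : Measurable Y) (E : Set Ω) {B : Set ℝ} (hB : MeasurableSet B) :
    lawOn μ Y E B = μ (Y ⁻¹' B ∩ E) := by
  rw [lawOn, Measure.map_apply hY hB, Measure.restrict_apply (hY hB)]

theorem lawOn_le_map (hY : Measurable Y) (E : Set Ω) : lawOn μ Y E ≤ μ.map Y :=
  Measure.map_mono Measure.restrict_le_self hY

theorem lawOn_absolutelyContinuous (hY : Measurable Y) (E : Set Ω) : lawOn μ Y E ≪ μ.map Y :=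
  Measure.absolutelyContinuous_of_le (lawOn_le_map hY E)

theorem lawOn_compl_add_lawOn (hY : Measurable Y) {E : Set Ω} (hE : MeasurableSet E) :
    lawOn μ Y Eᶜ + lawOn μ Y E = μ.map Y := by
  rw [lawOn, lawOn, ← Measure.map_add _ _ hY, add_comm, Measure.restrict_add_restrict_compl hE]

theorem lawOn_preimage_comm (hX : Measurable X) (hY : Measurable Y) {A B : Set ℝ}
    (hA : MeasurableSet A) (hB : MeasurableSet B) :
    lawOn μ X (Y ⁻¹' B) A = lawOn μ Y (X ⁻¹' A) B := by
  rw [lawOn_apply hX _ hA, lawOn_apply hY _ hB, inter_comm]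

theorem tp2Ineq_iff_lawOn (hY : Measurable Y) {A₁ A₂ B₁ B₂ : Set ℝ} (hB₁ : MeasurableSet B₁)
    (hB₂ : MeasurableSet B₂) :
    TP2Ineq μ X Y A₁ A₂ B₁ B₂ ↔
      lawOn μ Y (X ⁻¹' A₁) B₂ * lawOn μ Y (X ⁻¹' A₂) B₁ ≤
        lawOn μ Y (X ⁻¹' A₁) B₁ * lawOn μ Y (X ⁻¹' A₂) B₂ := by
  simp only [TP2Ineq, lawOn_apply hY _ hB₁, lawOn_apply hY _ hB₂, inter_comm (X ⁻¹' _)]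

theorem iocRatioLE_lawOn (hY : Measurable Y) {A₁ A₂ : Set ℝ}
    (h : ∀ y₀ y₁ y₂ : ℝ, y₀ < y₁ → y₁ < y₂ → TP2Ineq μ X Y A₁ A₂ (Ioc y₀ y₁) (Ioc y₁ y₂)) :
    IocRatioLE (lawOn μ Y (X ⁻¹' A₁)) (lawOn μ Y (X ⁻¹' A₂)) := by
  intro a b c
  rcases le_or_gt b a with hba | hab
  · simp [Ioc_eq_empty_of_le hba]
  rcases le_or_gt c b with hcb | hbc
  · simp [Ioc_eq_empty_of_le hcb]
  exact (tp2Ineq_iff_lawOn hY measurableSet_Ioc measurableSet_Ioc).mp (h a b c hab hbc)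

theorem tp2Ineq_of_forall_Ioc [IsFiniteMeasure μ] (hY : Measurable Y) {A₁ A₂ B₁ B₂ : Set ℝ}
    (h : ∀ y₀ y₁ y₂ : ℝ, y₀ < y₁ → y₁ < y₂ → TP2Ineq μ X Y A₁ A₂ (Ioc y₀ y₁) (Ioc y₁ y₂))
    (hB₁ : MeasurableSet B₁) (hB₂ : MeasurableSet B₂) (hB : SetLT B₁ B₂) :
    TP2Ineq μ X Y A₁ A₂ B₁ B₂ :=
  (tp2Ineq_iff_lawOn hY hB₁ hB₂).mpr
    ((iocRatioLE_lawOn hY h).likelihoodRatioLE.measure_mul_le hB₁ hB₂ hB)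

theorem isTP2_of_forall_Ioc [IsFiniteMeasure μ] (hX : Measurable X) (hY : Measurable Y)
    (h : ∀ x₀ x₁ x₂ y₀ y₁ y₂ : ℝ, x₀ < x₁ → x₁ < x₂ → y₀ < y₁ → y₁ < y₂ →
      TP2Ineq μ X Y (Ioc x₀ x₁) (Ioc x₁ x₂) (Ioc y₀ y₁) (Ioc y₁ y₂)) : IsTP2 μ X Y := by
  intro A₁ A₂ B₁ B₂ hA₁ hA₂ hB₁ hB₂ hA hB
  refine tp2Ineq_comm.mp (tp2Ineq_of_forall_Ioc hX (fun x₀ x₁ x₂ hx₀ hx₁ => ?_) hA₁ hA₂ hA)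
  exact tp2Ineq_comm.mp (tp2Ineq_of_forall_Ioc hY
    (fun y₀ y₁ y₂ => h x₀ x₁ x₂ y₀ y₁ y₂ hx₀ hx₁) hB₁ hB₂ hB)

theorem cond_preimage_eq_div (hX : Measurable X) {A : Set ℝ} (hA : MeasurableSet A) (B : Set ℝ) :
    (cond μ (X ⁻¹' A)) (Y ⁻¹' B) = lawOn μ X (Y ⁻¹' B) A / μ.map X A := by
  rw [cond_apply (hX hA), lawOn_apply hX _ hA, Measure.map_apply hX hA, ENNReal.div_eq_inv_mul]

theorem leftSup_eq_leftRatio (hX : Measurable X) (x y : ℝ) :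
    leftSup μ X Y x y = leftRatio (lawOn μ X (Y ⁻¹' Ioi y)) (μ.map X) x := by
  simp only [leftSup, leftRatio, cond_preimage_eq_div hX measurableSet_Ioc]
  refine iSup_congr fun a => ?_
  rcases lt_or_ge a x with hax | hxa
  · simp [hax]
  · simp [Ioc_eq_empty_of_le hxa]

theorem cond_le_leftSup (hX : Measurable X) (a x y : ℝ) :
    (cond μ (X ⁻¹' Ioc a x)) (Y ⁻¹' Ioi y) ≤ leftSup μ X Y x y := by
  rw [leftSup_eq_leftRatio hX, cond_preimage_eq_div hX measurableSet_Ioc]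
  exact le_iSup (fun a => lawOn μ X (Y ⁻¹' Ioi y) (Ioc a x) / μ.map X (Ioc a x)) a

theorem antitone_leftSup (μ : Measure Ω) (X Y : Ω → ℝ) (x : ℝ) : Antitone (leftSup μ X Y x) :=
  fun _ _ hyz => iSup₂_mono fun _ _ => measure_mono (preimage_mono (Ioi_subset_Ioi hyz))

theorem lowerSemicontinuous_leftSup (hY : Measurable Y) (x : ℝ) :
    LowerSemicontinuous (leftSup μ X Y x) := by
  refine lowerSemicontinuous_biSup fun a _ => ?_
  simp only [← Measure.map_apply hY measurableSet_Ioi]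
  exact lowerSemicontinuous_measure_Ioi _

theorem mem_rangeOf_iff (hX : Measurable X) {x : ℝ} :
    x ∈ rangeOf μ X ↔ μ.map X (Iic x) ≠ 0 ∧ μ.map X (Ici x) ≠ 0 := by
  rw [Measure.map_apply hX measurableSet_Iic, Measure.map_apply hX measurableSet_Ici,
    ← pos_iff_ne_zero, ← pos_iff_ne_zero]
  rfl

theorem measurableSet_rangeOf (μ : Measure Ω) (X : Ω → ℝ) : MeasurableSet (rangeOf μ X) := by
  refine OrdConnected.measurableSet ⟨fun x hx z hz y hy => ⟨?_, ?_⟩⟩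
  · exact hx.1.trans_le (measure_mono fun ω (hω : X ω ≤ x) => hω.trans hy.1)
  · exact hz.2.trans_le (measure_mono fun ω (hω : z ≤ X ω) => hy.2.trans hω)

theorem ae_mem_rangeOf (hX : Measurable X) : ∀ᵐ x ∂μ.map X, x ∈ rangeOf μ X := by
  filter_upwards [ae_measure_Iic_ne_zero (μ.map X), ae_measure_Ici_ne_zero (μ.map X)]
    with x hIic hIci using (mem_rangeOf_iff hX).mpr ⟨hIic, hIci⟩

theorem lintegral_indicator_comp (hX : Measurable X) {f : ℝ → ℝ≥0∞} (hf : Measurable f)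
    {A : Set ℝ} (hA : MeasurableSet A) :
    ∫⁻ ω, A.indicator f (X ω) ∂μ = ∫⁻ x in A, f x ∂μ.map X := by
  rw [← lintegral_indicator hA, lintegral_map (hf.indicator hA) hX]

theorem IsCondKernel.isTP2 {K : Kernel ℝ ℝ} (hK : IsCondKernel μ X Y K)
    (hLR : IsLRIsotonic μ X K) (hX : Measurable X) : IsTP2 μ X Y := by
  intro A₁ A₂ B₁ B₂ hA₁ hA₂ hB₁ hB₂ hA hB
  have hdis : ∀ A B : Set ℝ, MeasurableSet A → MeasurableSet B →
      μ (X ⁻¹' A ∩ Y ⁻¹' B) = ∫⁻ x in A, K x B ∂μ.map X := fun A B hA hB =>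
    (hK.disintegrate A B hA hB).trans (lintegral_indicator_comp hX (K.measurable_coe hB) hA)
  rw [TP2Ineq, hdis A₁ B₁ hA₁ hB₁, hdis A₁ B₂ hA₁ hB₂, hdis A₂ B₁ hA₂ hB₁, hdis A₂ B₂ hA₂ hB₂]
  refine lintegral_mul_lintegral_mono_ae (K.measurable_coe hB₂) (K.measurable_coe hB₁)
    (K.measurable_coe hB₁) (K.measurable_coe hB₂) ?_
  filter_upwards [ae_restrict_mem hA₁, ae_restrict_of_ae (ae_mem_rangeOf hX)] with s hs hs'
  filter_upwards [ae_restrict_mem hA₂, ae_restrict_of_ae (ae_mem_rangeOf hX)] with t ht ht'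
  exact (hLR s hs' t ht' (hA s hs t ht)).measure_mul_le hB₁ hB₂ hB

theorem exists_measure_Ioc_ne_zero (hX : Measurable X) {x : ℝ} (hx : x ∈ rangeOf μ X) :
    ∃ a, μ.map X (Ioc a x) ≠ 0 :=
  ((tendsto_measure_Ioc_atBot (μ.map X) x).eventually_ne ((mem_rangeOf_iff hX).mp hx).1).exists

theorem map_cond_eq_smul_lawOn (μ : Measure Ω) (Y : Ω → ℝ) (E : Set Ω) :
    (cond μ E).map Y = (μ E)⁻¹ • lawOn μ Y E :=
  Measure.map_smul _ _ _

theorem IsTP2.iocRatioLE_map (h : IsTP2 μ X Y) (hX : Measurable X) (hY : Measurable Y) (y : ℝ) :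
    IocRatioLE (μ.map X) (lawOn μ X (Y ⁻¹' Ioi y)) := by
  rw [← lawOn_compl_add_lawOn hX (hY measurableSet_Ioi), ← preimage_compl, compl_Ioi]
  exact (iocRatioLE_lawOn hX fun a b c _ _ => tp2Ineq_comm.mp <|
    h _ _ _ _ measurableSet_Ioc measurableSet_Ioc measurableSet_Iic measurableSet_Ioi
      (setLT_Ioc a b c) fun _ hs _ ht => lt_of_le_of_lt hs ht).add_left

theorem IsTP2.iocRatioLE_map_cond (h : IsTP2 μ X Y) (hY : Measurable Y) {A₁ A₂ : Set ℝ}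
    (hA₁ : MeasurableSet A₁) (hA₂ : MeasurableSet A₂) (hA : SetLT A₁ A₂) :
    IocRatioLE ((cond μ (X ⁻¹' A₁)).map Y) ((cond μ (X ⁻¹' A₂)).map Y) := by
  simp only [map_cond_eq_smul_lawOn]
  exact (iocRatioLE_lawOn hY fun a b c _ _ =>
    h _ _ _ _ hA₁ hA₂ measurableSet_Ioc measurableSet_Ioc hA (setLT_Ioc a b c)).smul _ _

theorem IsExplicitKernel.eq_of_measure_Ioc_eq_zero {K : Kernel ℝ ℝ} [IsMarkovKernel K]
    (hK : IsExplicitKernel μ X Y K) (hX : Measurable X) {x₁ x₂ : ℝ} (hx₁ : x₁ ∈ rangeOf μ X)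
    (hx₂ : x₂ ∈ rangeOf μ X) (hx : x₁ ≤ x₂) (h0 : μ.map X (Ioc x₁ x₂) = 0) : K x₁ = K x₂ := by
  refine measure_ext_of_Ioi (by simp) fun y => ?_
  rw [hK.1 x₁ hx₁, hK.1 x₂ hx₂, leftSup_eq_leftRatio hX, leftSup_eq_leftRatio hX]
  exact leftRatio_eq_of_measure_Ioc_eq_zero (lawOn_absolutelyContinuous hX _) hx h0

section Finite

variable [IsFiniteMeasure μ]

theorem IsTP2.tendsto_map_cond (h : IsTP2 μ X Y) (hX : Measurable X) (hY : Measurable Y)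
    (x y : ℝ) :
    Tendsto (fun a : {a // μ.map X (Ioc a x) ≠ 0} => (cond μ (X ⁻¹' Ioc a x)).map Y (Ioi y)) atTop
      (𝓝 (leftSup μ X Y x y)) := by
  simp only [Measure.map_apply hY measurableSet_Ioi, cond_preimage_eq_div hX measurableSet_Ioc,
    leftSup_eq_leftRatio hX]
  exact (h.iocRatioLE_map hX hY y).tendsto_leftRatio (lawOn_absolutelyContinuous hX _) x

theorem tendsto_leftSup_atBot (hX : Measurable X) (hY : Measurable Y) {x : ℝ}
    (hx : x ∈ rangeOf μ X) : Tendsto (leftSup μ X Y x) atBot (𝓝 1) := by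
  obtain ⟨a, ha⟩ := exists_measure_Ioc_ne_zero hX hx
  rw [Measure.map_apply hX measurableSet_Ioc] at ha
  have := cond_isProbabilityMeasure ha
  have hlim := tendsto_measure_Ioi_atBot ((cond μ (X ⁻¹' Ioc a x)).map Y)
  rw [Measure.map_apply hY .univ, preimage_univ, measure_univ] at hlim
  refine tendsto_of_tendsto_of_tendsto_of_le_of_le hlim tendsto_const_nhds (fun y => ?_) fun y => ?_
  · simpa only [Measure.map_apply hY measurableSet_Ioi] using cond_le_leftSup hX a x y
  · rw [leftSup_eq_leftRatio hX]
    exact leftRatio_le_one (lawOn_le_map hX _) x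

theorem IsTP2.tendsto_leftSup_atTop (h : IsTP2 μ X Y) (hX : Measurable X) (hY : Measurable Y)
    {x : ℝ} (hx : x ∈ rangeOf μ X) : Tendsto (leftSup μ X Y x) atTop (𝓝 0) := by
  have hpos : μ.map X (Ici x) ≠ 0 := ((mem_rangeOf_iff hX).mp hx).2
  have hle : ∀ y, leftSup μ X Y x y ≤ μ.map Y (Ioi y) / μ.map X (Ici x) := fun y => by
    rw [ENNReal.le_div_iff_mul_le (.inl hpos) (.inl (measure_ne_top _ _)), leftSup_eq_leftRatio hX]
    refine ((h.iocRatioLE_map hX hY y).leftRatio_mul_measure_Ici_le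
      (lawOn_absolutelyContinuous hX _) x).trans ?_
    rw [lawOn_preimage_comm hX hY measurableSet_Ici measurableSet_Ioi]
    exact lawOn_le_map hY _ _
  have hlim : Tendsto (fun y => μ.map Y (Ioi y) / μ.map X (Ici x)) atTop (𝓝 0) := by
    simpa using ENNReal.Tendsto.div_const (tendsto_measure_Ioi_atTop (μ.map Y)) (.inr hpos)
  exact tendsto_of_tendsto_of_tendsto_of_le_of_le tendsto_const_nhds hlim (fun _ => zero_le) hle

theorem IsTP2.exists_measure_Ioi_eq_leftSup (h : IsTP2 μ X Y) (hX : Measurable X)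
    (hY : Measurable Y) {x : ℝ} (hx : x ∈ rangeOf μ X) :
    ∃ P : Measure ℝ, IsProbabilityMeasure P ∧ ∀ y, P (Ioi y) = leftSup μ X Y x y :=
  exists_isProbabilityMeasure_Ioi (antitone_leftSup μ X Y x) (lowerSemicontinuous_leftSup hY x)
    (tendsto_leftSup_atBot hX hY hx) (h.tendsto_leftSup_atTop hX hY hx)

theorem IsTP2.measurable_leftSup (h : IsTP2 μ X Y) (hX : Measurable X) (hY : Measurable Y)
    (y : ℝ) : Measurable fun x => leftSup μ X Y x y := by
  simp only [leftSup_eq_leftRatio hX]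
  exact ((h.iocRatioLE_map hX hY y).monotone_leftRatio (lawOn_absolutelyContinuous hX _)).measurable

theorem IsTP2.lawOn_Ioi_eq_setLIntegral (h : IsTP2 μ X Y) (hX : Measurable X) (hY : Measurable Y)
    {A : Set ℝ} (hA : MeasurableSet A) (y : ℝ) :
    lawOn μ Y (X ⁻¹' A) (Ioi y) = ∫⁻ x in A, leftSup μ X Y x y ∂μ.map X := by
  simp only [leftSup_eq_leftRatio hX]
  rw [← lawOn_preimage_comm hX hY hA measurableSet_Ioi, ← withDensity_apply _ hA,
    (h.iocRatioLE_map hX hY y).withDensity_leftRatio (lawOn_absolutelyContinuous hX _)]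

section Explicit

variable {K : Kernel ℝ ℝ} [IsMarkovKernel K]

theorem IsExplicitKernel.lawOn_eq_bind (hK : IsExplicitKernel μ X Y K) (h : IsTP2 μ X Y)
    (hX : Measurable X) (hY : Measurable Y) {A : Set ℝ} (hA : MeasurableSet A) :
    lawOn μ Y (X ⁻¹' A) = ((μ.map X).restrict A).bind K := by
  refine measure_ext_of_Ioi ?_ fun y => ?_
  · rw [lawOn_apply hY _ .univ, Measure.bind_apply .univ K.aemeasurable]
    simp [Measure.map_apply hX hA]
  · rw [h.lawOn_Ioi_eq_setLIntegral hX hY hA,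
      Measure.bind_apply measurableSet_Ioi K.aemeasurable]
    refine lintegral_congr_ae (ae_restrict_of_ae ?_)
    filter_upwards [ae_mem_rangeOf hX] with x hx using (hK.1 x hx y).symm

theorem IsExplicitKernel.isCondKernel (hK : IsExplicitKernel μ X Y K) (h : IsTP2 μ X Y)
    (hX : Measurable X) (hY : Measurable Y) : IsCondKernel μ X Y K := by
  refine ⟨inferInstance, fun A B hA hB => ?_⟩
  rw [lintegral_indicator_comp hX (K.measurable_coe hB) hA, inter_comm, ← lawOn_apply hY _ hB,
    hK.lawOn_eq_bind h hX hY hA, Measure.bind_apply hB K.aemeasurable]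

theorem IsExplicitKernel.iocRatioLE (hK : IsExplicitKernel μ X Y K) (h : IsTP2 μ X Y)
    (hX : Measurable X) (hY : Measurable Y) {x₁ x₂ : ℝ} (hx₁ : x₁ ∈ rangeOf μ X)
    (hx₂ : x₂ ∈ rangeOf μ X) (h0 : μ.map X (Ioc x₁ x₂) ≠ 0) : IocRatioLE (K x₁) (K x₂) := by
  have hlim : ∀ x ∈ rangeOf μ X, ∀ y, Tendsto (fun a : {a // μ.map X (Ioc a x) ≠ 0} =>
      (cond μ (X ⁻¹' Ioc a x)).map Y (Ioi y)) atTop (𝓝 (K x (Ioi y))) := fun x hx y => by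
    rw [hK.1 x hx y]
    exact h.tendsto_map_cond hX hY x y
  obtain ⟨a, ha⟩ := exists_measure_Ioc_ne_zero hX hx₁
  have : Nonempty {a // μ.map X (Ioc a x₁) ≠ 0} := ⟨a, ha⟩
  have : Nonempty {a // μ.map X (Ioc a x₂) ≠ 0} := ⟨x₁, h0⟩
  refine IocRatioLE.of_tendsto_Ioi
    (l := (atTop : Filter {a // μ.map X (Ioc a x₁) ≠ 0}) ×ˢ
      (atTop : Filter {a // μ.map X (Ioc a x₂) ≠ 0}))
    (p := fun a => (cond μ (X ⁻¹' Ioc a.1 x₁)).map Y)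
    (q := fun a => (cond μ (X ⁻¹' Ioc a.2 x₂)).map Y) ?_
    (fun y => (hlim x₁ hx₁ y).comp tendsto_fst) fun y => (hlim x₂ hx₂ y).comp tendsto_snd
  filter_upwards [tendsto_snd.eventually (eventually_ge_atTop ⟨x₁, h0⟩)] with a ha
  exact h.iocRatioLE_map_cond hY measurableSet_Ioc measurableSet_Ioc fun s hs t ht =>
    hs.2.trans_lt (lt_of_le_of_lt ha ht.1)

theorem IsExplicitKernel.isLRIsotonic (hK : IsExplicitKernel μ X Y K) (h : IsTP2 μ X Y)
    (hX : Measurable X) (hY : Measurable Y) : IsLRIsotonic μ X K := by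
  intro x₁ hx₁ x₂ hx₂ hx
  rcases eq_or_ne (μ.map X (Ioc x₁ x₂)) 0 with h0 | h0
  · rw [hK.eq_of_measure_Ioc_eq_zero hX hx₁ hx₂ hx.le h0]
    exact .refl _
  · exact (hK.iocRatioLE h hX hY hx₁ hx₂ h0).likelihoodRatioLE

end Explicit

end Finite

theorem IsTP2.exists_isExplicitKernel [IsProbabilityMeasure μ] (h : IsTP2 μ X Y)
    (hX : Measurable X) (hY : Measurable Y) :
    ∃ K : Kernel ℝ ℝ, IsMarkovKernel K ∧ IsExplicitKernel μ X Y K := by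
  have hex : ∀ x, ∃ P : Measure ℝ, IsProbabilityMeasure P ∧
      (x ∈ rangeOf μ X → ∀ y, P (Ioi y) = leftSup μ X Y x y) ∧
      (x ∉ rangeOf μ X → P = μ.map Y) := fun x => by
    by_cases hx : x ∈ rangeOf μ X
    · obtain ⟨P, hP, hPy⟩ := h.exists_measure_Ioi_eq_leftSup hX hY hx
      exact ⟨P, hP, fun _ => hPy, fun hx' => absurd hx hx'⟩
    · exact ⟨μ.map Y, Measure.isProbabilityMeasure_map hY.aemeasurable, fun hx' => absurd hx' hx,
        fun _ => rfl⟩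
  choose κ hκ hκ_range hκ_compl using hex
  have hmeas : Measurable κ := by
    refine Measurable.measure_of_isPiSystem_of_isProbabilityMeasure
      (BorelSpace.measurable_eq.trans (borel_eq_generateFrom_Ioi ℝ)) isPiSystem_Ioi ?_
    rintro _ ⟨y, rfl⟩
    classical
    have hκ_Ioi : (fun x => κ x (Ioi y)) =
        fun x => if x ∈ rangeOf μ X then leftSup μ X Y x y else μ.map Y (Ioi y) := by
      ext x
      split_ifs with hx
      · exact hκ_range x hx y
      · rw [hκ_compl x hx]
    rw [hκ_Ioi]
    exact (h.measurable_leftSup hX hY y).ite (measurableSet_rangeOf μ X) measurable_const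
  exact ⟨⟨κ, hmeas⟩, ⟨hκ⟩, hκ_range, hκ_compl⟩

end RandomPair
end LRKernel

theorem theorem2 {Ω : Type*} [MeasurableSpace Ω] (μ : Measure Ω) [IsProbabilityMeasure μ]
    (X Y : Ω → ℝ) (hX : Measurable X) (hY : Measurable Y) :
    List.TFAE [
      ∀ A₁ A₂ B₁ B₂ : Set ℝ, MeasurableSet A₁ → MeasurableSet A₂ → MeasurableSet B₁ →
        MeasurableSet B₂ → LRKernel.SetLT A₁ A₂ → LRKernel.SetLT B₁ B₂ →
        LRKernel.TP2Ineq μ X Y A₁ A₂ B₁ B₂,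
      ∀ x₀ x₁ x₂ y₀ y₁ y₂ : ℝ, x₀ < x₁ → x₁ < x₂ → y₀ < y₁ → y₁ < y₂ →
        LRKernel.TP2Ineq μ X Y (Ioc x₀ x₁) (Ioc x₁ x₂) (Ioc y₀ y₁) (Ioc y₁ y₂),
      ∃ K : Kernel ℝ ℝ, LRKernel.IsCondKernel μ X Y K ∧ LRKernel.IsLRIsotonic μ X K] ∧
    ((∀ x₀ x₁ x₂ y₀ y₁ y₂ : ℝ, x₀ < x₁ → x₁ < x₂ → y₀ < y₁ → y₁ < y₂ →
        LRKernel.TP2Ineq μ X Y (Ioc x₀ x₁) (Ioc x₁ x₂) (Ioc y₀ y₁) (Ioc y₁ y₂)) →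
      ∃ K : Kernel ℝ ℝ, LRKernel.IsExplicitKernel μ X Y K ∧ LRKernel.IsCondKernel μ X Y K ∧
        LRKernel.IsLRIsotonic μ X K) := by
  have explicit : LRKernel.IsTP2 μ X Y → ∃ K : Kernel ℝ ℝ, LRKernel.IsExplicitKernel μ X Y K ∧
      LRKernel.IsCondKernel μ X Y K ∧ LRKernel.IsLRIsotonic μ X K := fun h => by
    obtain ⟨K, _, hK⟩ := h.exists_isExplicitKernel hX hY
    exact ⟨K, hK, hK.isCondKernel h hX hY, hK.isLRIsotonic h hX hY⟩
  refine ⟨?_, fun h => explicit (LRKernel.isTP2_of_forall_Ioc hX hY h)⟩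
  tfae_have 1 → 2 := fun h x₀ x₁ x₂ y₀ y₁ y₂ _ _ _ _ =>
    h _ _ _ _ measurableSet_Ioc measurableSet_Ioc measurableSet_Ioc measurableSet_Ioc
      (LRKernel.setLT_Ioc x₀ x₁ x₂) (LRKernel.setLT_Ioc y₀ y₁ y₂)
  tfae_have 2 → 1 := LRKernel.isTP2_of_forall_Ioc hX hY
  tfae_have 1 → 3 := fun h =>
    let ⟨K, _, hK⟩ := explicit h
    ⟨K, hK⟩
  tfae_have 3 → 1 := fun ⟨_, hK, hLR⟩ => hK.isTP2 hLR hX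
  tfae_finish
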